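/- A Galois extension $L/k$ of number fields is called locally cyclic if its decomposition group at every prime of $L$ is cyclic. Let $G$ be a finite group, $N\le Z(G)$ a nontrivial cyclic central subgroup, and $H:=G/N$. Let $K/\mathbb{Q}$ be a locally cyclic Galois extension with an identification $\varphi\colon \mathrm{Gal}(K/\mathbb{Q})\xrightarrow{\sim} H$. Say that $K$ embeds into a Galois extension $L/\mathbb{Q}$ with group $G$ if $K\subseteq L$ and there is an isomorphism $\psi\colon \mathrm{Gal}(L/\mathbb{Q})\xrightarrow{\sim} G$ such that $\psi(\sigma)N=\varphi(\sigma|_K)$ for all $\sigma\in\mathrm{Gal}(L/\mathbb{Q})$ (in particular $\psi$ maps $\mathrm{Gal}(L/K)$ onto $N$). Fix an algebraic closure $\overline{K}$ of $K$; all extensions of $K$ are taken inside $\overline{K}$. If $K$ embeds into at least one locally cyclic Galois extension of $\mathbb{Q}$ with group $G$, then there is an infinite set of locally cyclic Galois extensions of $\mathbb{Q}$ with group $G$ into which $K$ embeds and which are pairwise linearly disjoint over $K$. -/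

import Mathlib

open NumberField
open scoped Pointwise

/-- A Galois extension `L/k` of number fields is *locally cyclic* if its decomposition group at
every prime of `L`, finite or infinite, is cyclic. The decomposition group at a prime is its
stabilizer in `Gal(L/k)`. -/
structure IsLocallyCyclic (k L : Type*) [Field k] [NumberField k] [Field L] [NumberField L]
    [Algebra k L] [IsGalois k L] : Prop where
  finitePrimes : ∀ P : Ideal (𝓞 L), P.IsPrime → P ≠ ⊥ →
    IsCyclic (MulAction.stabilizer Gal(L/k) P)
  infinitePrimes : ∀ w : InfinitePlace L, IsCyclic (MulAction.stabilizer Gal(L/k) w)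

/-- Let `K/ℚ` be a Galois extension of number fields whose Galois group is identified with `G ⧸ N`
by `φ`, and let `L` be an extension of `K` inside a fixed algebraic closure of `K`.
`IsLocallyCyclicEmbedding φ L` says that `L/ℚ` is a locally cyclic Galois extension of number
fields with group `G` which extends the `G ⧸ N`-extension `K/ℚ`: there is an isomorphism
`Gal(L/ℚ) ≃ G` under which the restriction map `Gal(L/ℚ) → Gal(K/ℚ)` becomes the projection
`G → G ⧸ N`. -/
def IsLocallyCyclicEmbedding {G : Type*} [Group G] {N : Subgroup G} [N.Normal]
    {K : Type*} [Field K] [NumberField K] [IsGalois ℚ K] (φ : Gal(K/ℚ) ≃* G ⧸ N)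
    (L : IntermediateField K (AlgebraicClosure K)) : Prop :=
  ∃ (_ : NumberField L) (_ : IsGalois ℚ L), IsLocallyCyclic ℚ L ∧
    ∃ ψ : Gal(L/ℚ) ≃* G, ∀ σ : Gal(L/ℚ),
      QuotientGroup.mk' N (ψ σ) = φ (AlgEquiv.restrictNormalHom K σ)

/-!
The extensions are obtained from the given one by twisting. Write `Ω` for the algebraic closure of
`K` and `n` for the order of `N`. The given extension `L₀` amounts to a surjection
`θ₀ : Gal(Ω/ℚ) → G`. As `N` is central, `θ₀` can be multiplied by any character
`χ : Gal(Ω/ℚ) → N`, and `θ = θ₀ χ` still lifts `Gal(Ω/ℚ) → Gal(K/ℚ) ≃ G ⧸ N`. Here `χ` is taken of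
prime conductor `p`: it is the `p`-th cyclotomic character followed by a surjection `(ℤ/p)ˣ → N`.

The prime `p` is chosen to be large and completely split in a Galois number field containing `L₀`,
the `n`-th roots of unity, and `n`-th roots of all primes up to a bound beyond which nothing
ramifies in `L₀` (`exists_twisting_prime`). Then `p` splits completely in `L₀`, `n` divides `p - 1`,
and every prime `ℓ` that ramifies in `L₀` is an `n`-th power modulo `p`, so `χ` is trivial on
decomposition groups over `ℓ`. The image under `θ` of a decomposition group is therefore cyclic
(`isLocallyCyclic_of_twist`): over `p` it lies in `N`; over a prime ramified in `L₀` it is the image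
under `θ₀`; over any other prime it is generated by a Frobenius element, because `L₀(ζ_p)` is
unramified there. At infinite places decomposition groups have order at most two.

For linear disjointness, let `M₁` be a number field containing `L₀` and a given finite set of
twists. For almost all `p` the `p`-th cyclotomic field meets `M₁` in `ℚ`, so `χ` maps `Gal(Ω/M₁)`
onto `N` (`exists_bound_autToPow_surjective`). As `θ₀` is trivial there, every `σ ∈ Gal(Ω/K)`,
having `θ σ ∈ N`, agrees on the new field with an automorphism that is trivial on `M₁`; hence an
element lying both in the new field and in one of the given twists is fixed by all of `Gal(Ω/K)`,
and so lies in `K`.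
-/

/-! ### Auxiliary facts on fields and prime ideals -/

theorem IntermediateField.mem_fixedField_zpowers_iff {k Ω : Type*} [Field k] [Field Ω] [Algebra k Ω]
    {σ : Gal(Ω/k)} {x : Ω} :
    x ∈ IntermediateField.fixedField (Subgroup.zpowers σ) ↔ σ x = x := by
  rw [IntermediateField.mem_fixedField_iff]
  refine ⟨fun h => h σ (Subgroup.mem_zpowers σ), fun h g hg => ?_⟩
  have : Subgroup.zpowers σ ≤ MulAction.stabilizer Gal(Ω/k) x := Subgroup.zpowers_le.2 h
  exact this hg

theorem isGalois_rat_algebraicClosure (K : Type*) [Field K] [NumberField K] :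
    IsGalois ℚ (AlgebraicClosure K) := by
  have : Algebra.IsAlgebraic ℚ (AlgebraicClosure K) := Algebra.IsAlgebraic.trans ℚ K _
  have : IsAlgClosure ℚ (AlgebraicClosure K) := ⟨inferInstance, inferInstance⟩
  exact IsAlgClosure.isGalois ℚ _

theorem exists_isPrime_comap_eq {R S : Type*} [CommRing R] [CommRing S] [IsDomain S] [Algebra R S]
    [Algebra.IsIntegral R S] [FaithfulSMul R S] (Q : Ideal R) [Q.IsPrime] :
    ∃ P : Ideal S, P.IsPrime ∧ P.comap (algebraMap R S) = Q := by
  obtain ⟨P, -, hP, hPQ⟩ := Ideal.exists_ideal_over_prime_of_isIntegral Q (⊥ : Ideal S) (by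
    rw [← RingHom.ker_eq_comap_bot, (RingHom.injective_iff_ker_eq_bot _).1
      (FaithfulSMul.algebraMap_injective R S)]
    exact bot_le)
  exact ⟨P, hP, hPQ⟩

/-! ### Decomposition groups in towers and the action on residue fields -/

section Decomposition

variable {L M : Type*} [Field L] [NumberField L] [IsGalois ℚ L]
  [Field M] [NumberField M]

theorem algebraMap_restrictNormalHom_smul [Algebra L M] (σ : Gal(M/ℚ)) (x : 𝓞 L) :
    algebraMap (𝓞 L) (𝓞 M) (AlgEquiv.restrictNormalHom L σ • x) =
      σ • algebraMap (𝓞 L) (𝓞 M) x := by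
  apply RingOfIntegers.ext
  exact AlgEquiv.restrictNormal_commutes σ L (x : L)

theorem comap_smul_eq_smul_comap [Algebra L M] (σ : Gal(M/ℚ)) (P : Ideal (𝓞 M)) :
    (σ • P).comap (algebraMap (𝓞 L) (𝓞 M)) =
      AlgEquiv.restrictNormalHom L σ • P.comap (algebraMap (𝓞 L) (𝓞 M)) := by
  ext x
  rw [Ideal.mem_comap, Ideal.mem_pointwise_smul_iff_inv_smul_mem,
    Ideal.mem_pointwise_smul_iff_inv_smul_mem, Ideal.mem_comap, ← map_inv,
    algebraMap_restrictNormalHom_smul]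

theorem restrictNormalHom_mem_stabilizer [Algebra L M] {σ : Gal(M/ℚ)} {P : Ideal (𝓞 M)}
    (h : σ ∈ MulAction.stabilizer Gal(M/ℚ) P) :
    AlgEquiv.restrictNormalHom L σ ∈
      MulAction.stabilizer Gal(L/ℚ) (P.comap (algebraMap (𝓞 L) (𝓞 M))) := by
  rw [MulAction.mem_stabilizer_iff] at h ⊢
  rw [← comap_smul_eq_smul_comap, h]

theorem restrictNormalHom_mem_inertia [Algebra L M] {σ : Gal(M/ℚ)} {P : Ideal (𝓞 M)}
    (h : σ ∈ P.inertia Gal(M/ℚ)) :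
    AlgEquiv.restrictNormalHom L σ ∈
      (P.comap (algebraMap (𝓞 L) (𝓞 M))).inertia Gal(L/ℚ) := by
  intro x
  change algebraMap (𝓞 L) (𝓞 M) _ ∈ P
  rw [map_sub, algebraMap_restrictNormalHom_smul]
  exact h _

/-- Decomposition groups of a tower `M/L/ℚ` are related by restriction: every prime `Q` of `L` lies
under a prime `P` of `M` whose decomposition group surjects onto that of `Q`, because
`Gal(M/L)` permutes the primes over `Q` transitively. -/
theorem exists_prime_stabilizer_lift [Algebra L M] [IsGalois ℚ M] (Q : Ideal (𝓞 L))
    [Q.IsPrime] : ∃ P : Ideal (𝓞 M), P.IsPrime ∧ P.comap (algebraMap (𝓞 L) (𝓞 M)) = Q ∧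
      ∀ σ ∈ MulAction.stabilizer Gal(L/ℚ) Q, ∃ τ ∈ MulAction.stabilizer Gal(M/ℚ) P,
        AlgEquiv.restrictNormalHom L τ = σ := by
  obtain ⟨P, hP, hPQ⟩ := exists_isPrime_comap_eq (S := 𝓞 M) Q
  refine ⟨P, hP, hPQ, fun σ hσ => ?_⟩
  obtain ⟨τ, hτ⟩ := AlgEquiv.restrictNormalHom_surjective (F := ℚ) (K₁ := L) M σ
  have : IsGalois L M := IsGalois.tower_top_of_isGalois ℚ L M
  have hunder : (τ • P).under (𝓞 L) = P.under (𝓞 L) := by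
    change (τ • P).comap _ = P.comap _
    rw [comap_smul_eq_smul_comap, hτ, hPQ]
    exact hσ
  obtain ⟨g, hg⟩ := Algebra.IsInvariant.exists_smul_of_under_eq (𝓞 L) (𝓞 M) Gal(M/L) (τ • P) P
    hunder
  let g' : Gal(M/ℚ) := g.restrictScalars ℚ
  refine ⟨g' * τ, ?_, ?_⟩
  · rw [MulAction.mem_stabilizer_iff, mul_smul]
    exact hg.symm
  · rw [map_mul, hτ]
    convert one_mul σ
    ext x
    apply FaithfulSMul.algebraMap_injective L M
    refine (AlgEquiv.restrictNormal_commutes g' L x).trans ?_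
    exact g.commutes x

end Decomposition

section ResidueChar

variable {M : Type*} [Field M]

theorem liesOver_span_of_natCast_mem {P : Ideal (𝓞 M)} [P.IsPrime] {ℓ : ℕ} (hℓ : ℓ.Prime)
    (hP : (ℓ : 𝓞 M) ∈ P) : P.LiesOver (Ideal.span {(ℓ : ℤ)}) := by
  rw [Ideal.liesOver_iff]
  have hmax : (Ideal.span {(ℓ : ℤ)}).IsMaximal :=
    PrincipalIdealRing.isMaximal_of_irreducible (Nat.prime_iff_prime_int.1 hℓ).irreducible
  refine hmax.eq_of_le (Ideal.IsPrime.under ℤ P).ne_top ?_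
  rw [Ideal.span_singleton_le_iff_mem]
  simpa [Ideal.under] using hP

theorem exists_prime_natCast_mem (P : Ideal (𝓞 M)) [P.IsPrime] (hP : P ≠ ⊥) :
    ∃ ℓ : ℕ, ℓ.Prime ∧ (ℓ : 𝓞 M) ∈ P := by
  have : NeZero P := ⟨hP⟩
  refine ⟨_, Nat.absNorm_under_prime P, ?_⟩
  simpa [Ideal.under] using Int.absNorm_under_mem P

theorem intCast_mem_iff_dvd {P : Ideal (𝓞 M)} [P.IsPrime] {ℓ : ℕ} (hℓ : ℓ.Prime)
    (hP : (ℓ : 𝓞 M) ∈ P) (a : ℤ) : (a : 𝓞 M) ∈ P ↔ (ℓ : ℤ) ∣ a := by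
  have := liesOver_span_of_natCast_mem hℓ hP
  rw [← Ideal.mem_span_singleton, Ideal.mem_of_liesOver P (Ideal.span {(ℓ : ℤ)})]
  simp

theorem ne_bot_of_natCast_mem [CharZero M] {P : Ideal (𝓞 M)} {ℓ : ℕ} (hℓ : ℓ.Prime)
    (hP : (ℓ : 𝓞 M) ∈ P) : P ≠ ⊥ := by
  rintro rfl
  exact hℓ.ne_zero (by exact_mod_cast (Ideal.mem_bot.1 hP))

variable [NumberField M]

attribute [local instance] Ideal.Quotient.field in
/-- The decomposition group acts on the residue field through powers of the Frobenius. -/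
theorem exists_pow_frobenius_of_mem_stabilizer {P : Ideal (𝓞 M)} [P.IsPrime]
    {ℓ : ℕ} (hℓ : ℓ.Prime) (hP : (ℓ : 𝓞 M) ∈ P) {σ : Gal(M/ℚ)}
    (hσ : σ ∈ MulAction.stabilizer Gal(M/ℚ) P) :
    ∃ k : ℕ, ∀ x : 𝓞 M, σ • x - x ^ ℓ ^ k ∈ P := by
  have hlies := liesOver_span_of_natCast_mem hℓ hP
  have hbot := ne_bot_of_natCast_mem hℓ hP
  have hmaxP : P.IsMaximal := Ideal.IsPrime.isMaximal ‹_› hbot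
  have hmax : (Ideal.span {(ℓ : ℤ)}).IsMaximal :=
    PrincipalIdealRing.isMaximal_of_irreducible (Nat.prime_iff_prime_int.1 hℓ).irreducible
  have : NeZero ℓ := ⟨hℓ.ne_zero⟩
  have : Fintype (ℤ ⧸ Ideal.span {(ℓ : ℤ)}) :=
    Fintype.ofEquiv _ (Int.quotientSpanNatEquivZMod ℓ).symm.toEquiv
  have hcard : Fintype.card (ℤ ⧸ Ideal.span {(ℓ : ℤ)}) = ℓ := by
    rw [Fintype.card_congr (Int.quotientSpanNatEquivZMod ℓ).toEquiv, ZMod.card]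
  have : Finite (𝓞 M ⧸ P) := Ideal.finiteQuotientOfFreeOfNeBot P hbot
  obtain ⟨k, hk⟩ := (FiniteField.bijective_frobeniusAlgEquivOfAlgebraic_pow
    (ℤ ⧸ Ideal.span {(ℓ : ℤ)}) (𝓞 M ⧸ P)).2
    (Ideal.Quotient.stabilizerHom P (Ideal.span {(ℓ : ℤ)}) Gal(M/ℚ) ⟨σ, hσ⟩)
  refine ⟨k, fun x => ?_⟩
  have := DFunLike.congr_fun hk (Ideal.Quotient.mk P x)
  simp only [AlgEquiv.coe_pow, FiniteField.coe_frobeniusAlgEquivOfAlgebraic_iterate, hcard,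
    Ideal.Quotient.stabilizerHom_apply, ← map_pow] at this
  rw [← Ideal.Quotient.eq]
  exact this.symm

attribute [local instance] Ideal.Quotient.field in
/-- Modulo inertia, the decomposition group embeds into the Galois group of the residue field, which
is cyclic. -/
theorem isCyclic_stabilizer_of_inertia_eq_bot {P : Ideal (𝓞 M)} [P.IsPrime] (hP : P ≠ ⊥)
    (h : P.inertia Gal(M/ℚ) = ⊥) : IsCyclic (MulAction.stabilizer Gal(M/ℚ) P) := by
  obtain ⟨ℓ, hℓ, hmem⟩ := exists_prime_natCast_mem P hP
  have hlies := liesOver_span_of_natCast_mem hℓ hmem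
  have hmaxP : P.IsMaximal := Ideal.IsPrime.isMaximal ‹_› hP
  have hmax : (Ideal.span {(ℓ : ℤ)}).IsMaximal :=
    PrincipalIdealRing.isMaximal_of_irreducible (Nat.prime_iff_prime_int.1 hℓ).irreducible
  have : Finite (𝓞 M ⧸ P) := Ideal.finiteQuotientOfFreeOfNeBot P hP
  refine isCyclic_of_injective
    (Ideal.Quotient.stabilizerHom P (Ideal.span {(ℓ : ℤ)}) Gal(M/ℚ)) ?_
  rw [← MonoidHom.ker_eq_bot_iff, Ideal.Quotient.ker_stabilizerHom, eq_bot_iff]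
  intro σ hσ
  have : (σ : Gal(M/ℚ)) ∈ P.inertia Gal(M/ℚ) := hσ
  rw [h] at this
  exact Subtype.ext this

end ResidueChar

/-! ### Primes that split completely -/

section SplitPrimes

variable {M : Type*} [Field M] [NumberField M]

/-- Reduction modulo `P` is injective on `n`-th roots of unity if `n ∉ P`: the sum of the powers of
a nontrivial root of unity vanishes, whereas it would be congruent to `n` if the root reduced
to `1`. -/
theorem eq_of_pow_eq_one_of_sub_mem {R : Type*} [CommRing R] [IsDomain R] {P : Ideal R}
    {n : ℕ} (hn : (n : R) ∉ P) {α β : R} (hα : α ^ n = 1) (hβ : β ^ n = 1) (h : α - β ∈ P) :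
    α = β := by
  have hn0 : n ≠ 0 := by rintro rfl; simp at hn
  obtain ⟨m, rfl⟩ := Nat.exists_eq_succ_of_ne_zero hn0
  -- `η` is the quotient of `α` by `β`, written without inverses.
  set η := α * β ^ m
  have hη : η - 1 ∈ P := by
    have : η - 1 = β ^ m * (α - β) := by
      rw [mul_sub, ← pow_succ, hβ, mul_comm]
    exact this ▸ P.mul_mem_left _ h
  have hηn : η ^ (m + 1) = 1 := by
    rw [mul_pow, ← pow_mul, mul_comm m, pow_mul, hα, hβ, one_pow, mul_one]
  have hη1 : η = 1 := by
    by_contra hne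
    have hsum : ∑ i ∈ Finset.range (m + 1), η ^ i = 0 := by
      have := geom_sum_mul η (m + 1)
      rw [hηn, sub_self, mul_eq_zero] at this
      exact this.resolve_right (sub_ne_zero.2 hne)
    apply hn
    have hmk : Ideal.Quotient.mk P η = 1 := by
      rw [← map_one (Ideal.Quotient.mk P)]; exact (Ideal.Quotient.eq).2 hη
    have := congrArg (Ideal.Quotient.mk P) hsum
    rw [map_sum] at this
    simp only [map_pow, hmk, one_pow, Finset.sum_const, Finset.card_range, nsmul_eq_mul,
      mul_one, map_zero] at this
    rw [← Ideal.Quotient.eq_zero_iff_mem]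
    simpa using this
  calc α = α * β ^ (m + 1) := by rw [hβ, mul_one]
    _ = η * β := by simp only [η]; ring
    _ = β := by rw [hη1, one_mul]

/-- A nonzero algebraic integer lies in no prime over a large rational prime, since its norm does
not. -/
theorem exists_bound_notMem_prime {y : 𝓞 M} (hy : y ≠ 0) :
    ∃ B : ℕ, ∀ ℓ : ℕ, ℓ.Prime → B < ℓ → ∀ P : Ideal (𝓞 M), P.IsPrime → (ℓ : 𝓞 M) ∈ P → y ∉ P := by
  refine ⟨Ideal.absNorm (Ideal.span {y}), fun ℓ hℓ hB P hP hmem hyP => ?_⟩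
  have h1 : ((Ideal.absNorm (Ideal.span {y}) : ℤ) : 𝓞 M) ∈ P := by
    rw [Int.cast_natCast]
    exact (Ideal.span_singleton_le_iff_mem P).2 hyP (Ideal.absNorm_mem _)
  rw [intCast_mem_iff_dvd hℓ hmem, Int.natCast_dvd_natCast] at h1
  have h0 : Ideal.absNorm (Ideal.span {y}) ≠ 0 := by
    rw [Ne, Ideal.absNorm_eq_zero_iff, Ideal.span_singleton_eq_bot]
    exact hy
  exact absurd (Nat.le_of_dvd (Nat.pos_of_ne_zero h0) h1) (not_le.2 hB)

theorem exists_algEquiv_smul_ne {σ : Gal(M/ℚ)} (hσ : σ ≠ 1) : ∃ x : 𝓞 M, σ • x ≠ x := by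
  by_contra! h
  apply hσ
  ext z
  obtain ⟨a, b, hb, rfl⟩ := IsFractionRing.div_surjective (𝓞 M) z
  have ha : σ (algebraMap (𝓞 M) M a) = algebraMap (𝓞 M) M a := congrArg (algebraMap (𝓞 M) M) (h a)
  have hb : σ (algebraMap (𝓞 M) M b) = algebraMap (𝓞 M) M b := congrArg (algebraMap (𝓞 M) M) (h b)
  simp [ha, hb]

/-- Only finitely many primes ramify: an automorphism `σ` in the inertia group of `P` forces
`σ x - x ∈ P` for an `x` moved by `σ`. -/
theorem exists_bound_inertia_eq_bot (M : Type*) [Field M] [NumberField M] :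
    ∃ B : ℕ, ∀ ℓ : ℕ, ℓ.Prime → B < ℓ → ∀ P : Ideal (𝓞 M), P.IsPrime → (ℓ : 𝓞 M) ∈ P →
      P.inertia Gal(M/ℚ) = ⊥ := by
  classical
  choose! x hx using fun (σ : Gal(M/ℚ)) (hσ : σ ≠ 1) => exists_algEquiv_smul_ne hσ
  obtain ⟨B, hB⟩ := exists_bound_notMem_prime
    (y := ∏ σ ∈ (Finset.univ : Finset Gal(M/ℚ)).erase 1, (σ • x σ - x σ))
    (Finset.prod_ne_zero_iff.2 fun σ hσ => sub_ne_zero.2 (hx σ (Finset.ne_of_mem_erase hσ)))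
  refine ⟨B, fun ℓ hℓ hlt P hP hmem => (Subgroup.eq_bot_iff_forall _).2 fun σ hσ => ?_⟩
  by_contra hne
  exact hB ℓ hℓ hlt P hP hmem (Ideal.mem_of_dvd _
    (Finset.dvd_prod_of_mem _ (Finset.mem_erase.2 ⟨hne, Finset.mem_univ σ⟩)) (hσ (x σ)))

/-- Schur's theorem: the values of a nonconstant integer polynomial have infinitely many prime
divisors. -/
theorem Polynomial.exists_prime_gt_dvd_eval (f : Polynomial ℤ) (hf : 0 < f.natDegree) (B : ℕ) :
    ∃ p : ℕ, p.Prime ∧ B < p ∧ ∃ k : ℤ, (p : ℤ) ∣ f.eval k := by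
  set c := f.eval 0 with hc
  by_cases hc0 : c = 0
  · obtain ⟨p, hp, hpr⟩ := Nat.exists_infinite_primes (B + 1)
    exact ⟨p, hpr, hp, 0, by rw [← hc, hc0]; exact dvd_zero _⟩
  -- For most `k`, the integer `f (c * B! * k) / c` is congruent to `1` modulo `B!` and not a unit.
  set m : ℤ := (B.factorial : ℤ)
  have hm : m ≠ 0 := Nat.cast_ne_zero.2 B.factorial_ne_zero
  have hne : ∀ a : ℤ, f - Polynomial.C a ≠ 0 := fun a h => by
    rw [sub_eq_zero.1 h] at hf
    simp at hf
  have hfin : {k : ℤ | (f - Polynomial.C c).IsRoot (c * m * k)}.Finite ∧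
      {k : ℤ | (f - Polynomial.C (-c)).IsRoot (c * m * k)}.Finite := by
    constructor <;>
    exact (Polynomial.finite_setOfPred_isRoot (hne _)).preimage
      (mul_right_injective₀ (mul_ne_zero hc0 hm)).injOn
  obtain ⟨k, hk⟩ := (hfin.1.union hfin.2).infinite_compl.nonempty
  simp only [Set.mem_compl_iff, Set.mem_union, Set.mem_ofPred_eq, Polynomial.IsRoot.def,
    Polynomial.eval_sub, Polynomial.eval_C, not_or, sub_eq_zero] at hk
  obtain ⟨s, hs⟩ := Polynomial.sub_dvd_eval_sub (c * m * k) 0 f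
  have hval : f.eval (c * m * k) = c * (1 + m * k * s) := by
    rw [← hc, sub_zero] at hs
    linear_combination hs
  have hunit : (1 + m * k * s).natAbs ≠ 1 := by
    intro h
    rcases Int.natAbs_eq_iff.1 h with h | h
    · exact hk.1 (by rw [hval, h]; simp)
    · exact hk.2 (by rw [hval, h]; simp)
  obtain ⟨p, hp, hpd⟩ := Nat.exists_prime_and_dvd hunit
  have hpd' : (p : ℤ) ∣ 1 + m * k * s := Int.natCast_dvd.2 hpd
  refine ⟨p, hp, ?_, _, hval ▸ hpd'.mul_left c⟩
  by_contra! hle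
  have hpm : (p : ℤ) ∣ m := Int.natCast_dvd_natCast.2 (hp.dvd_factorial.2 hle)
  have : (p : ℤ) ∣ 1 := (dvd_add_left ((hpm.mul_right k).mul_right s)).1 hpd'
  exact hp.one_lt.ne' (by exact_mod_cast Int.eq_one_of_dvd_one (by positivity) this)

/-- An integral primitive element, characterised by having no nontrivial automorphism fixing it. -/
theorem exists_integer_stabilizer_eq_bot (M : Type*) [Field M] [NumberField M] :
    ∃ α : 𝓞 M, ∀ τ : Gal(M/ℚ), τ • α = α → τ = 1 := by
  obtain ⟨β, hβ⟩ := Field.exists_primitive_element ℚ M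
  obtain ⟨⟨a, s, b, hb, hs⟩, h⟩ :=
    IsLocalization.surj (Algebra.algebraMapSubmonoid (𝓞 M) (nonZeroDivisors ℤ)) β
  refine ⟨a, fun τ hτ => ?_⟩
  have hs' : algebraMap (𝓞 M) M s = b := by rw [← hs]; simp
  have hb0 : (b : M) ≠ 0 := Int.cast_ne_zero.2 (nonZeroDivisors.ne_zero hb)
  have hfix : τ β = β := by
    have hτ' : τ (algebraMap (𝓞 M) M a) = algebraMap (𝓞 M) M a := congrArg (algebraMap (𝓞 M) M) hτ
    simp only [hs'] at h
    rw [← h, map_mul, map_intCast] at hτ'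
    exact mul_right_cancel₀ hb0 hτ'
  have hle : IntermediateField.adjoin ℚ {β} ≤
      IntermediateField.fixedField (Subgroup.zpowers τ) := by
    rw [IntermediateField.adjoin_simple_le_iff, IntermediateField.mem_fixedField_zpowers_iff]
    exact hfix
  ext x
  exact IntermediateField.mem_fixedField_zpowers_iff.1
    (hle (hβ ▸ IntermediateField.mem_top : x ∈ IntermediateField.adjoin ℚ {β}))

/-- Infinitely many primes split completely in a Galois number field: if `p` divides `f(k)`, where
`f` is the characteristic polynomial of an integral primitive element `α`, then a conjugate of
`α` is congruent to `k` modulo any prime over `p`, and only finitely many primes allow a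
nontrivial automorphism to preserve such a congruence. -/
theorem exists_prime_gt_stabilizer_eq_bot (M : Type*) [Field M] [NumberField M] [IsGalois ℚ M]
    (B : ℕ) : ∃ p : ℕ, p.Prime ∧ B < p ∧ ∀ P : Ideal (𝓞 M), P.IsPrime → (p : 𝓞 M) ∈ P →
      MulAction.stabilizer Gal(M/ℚ) P = ⊥ := by
  classical
  obtain ⟨α, hα⟩ := exists_integer_stabilizer_eq_bot M
  obtain ⟨C, hC⟩ := exists_bound_notMem_prime
    (y := ∏ σ : Gal(M/ℚ), ∏ τ ∈ (Finset.univ : Finset Gal(M/ℚ)).erase 1,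
      (τ • σ • α - σ • α))
    (Finset.prod_ne_zero_iff.2 fun σ _ => Finset.prod_ne_zero_iff.2 fun τ hτ => sub_ne_zero.2 (by
      intro h
      apply Finset.ne_of_mem_erase hτ
      have := hα (σ⁻¹ * τ * σ) (by rw [mul_smul, mul_smul, h, inv_smul_smul])
      simpa [mul_assoc] using conj_eq_one_iff (a := σ⁻¹) (b := τ) |>.1 (by simpa using this)))
  obtain ⟨f, hf⟩ := (Polynomial.mem_lifts _).1
    (Algebra.IsInvariant.charpoly_mem_lifts ℤ (𝓞 M) Gal(M/ℚ) α)
  have hdeg : 0 < f.natDegree := by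
    refine lt_of_lt_of_le ?_ (Polynomial.natDegree_map_le (f := algebraMap ℤ (𝓞 M)))
    rw [hf, MulSemiringAction.charpoly_eq,
      Polynomial.natDegree_prod_of_monic _ _ fun _ _ => Polynomial.monic_X_sub_C _]
    simp [Fintype.card_pos]
  obtain ⟨p, hp, hpB, k, hk⟩ := f.exists_prime_gt_dvd_eval hdeg (max B C)
  refine ⟨p, hp, (le_max_left _ _).trans_lt hpB, fun P hP hmem => ?_⟩
  have hprod : ∏ σ : Gal(M/ℚ), ((k : 𝓞 M) - σ • α) ∈ P := by
    have h1 := (intCast_mem_iff_dvd hp hmem _).2 hk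
    have h2 : ((f.eval k : ℤ) : 𝓞 M) = ∏ σ : Gal(M/ℚ), ((k : 𝓞 M) - σ • α) := by
      have := Polynomial.eval_intCast_map (algebraMap ℤ (𝓞 M)) f k
      rw [hf, MulSemiringAction.charpoly_eq, Polynomial.eval_prod] at this
      simpa using this.symm
    rwa [← h2]
  obtain ⟨σ, -, hσ⟩ := (Ideal.IsPrime.prod_mem_iff).1 hprod
  refine (Subgroup.eq_bot_iff_forall _).2 fun τ hτ => ?_
  by_contra hne
  have h1 : (k : 𝓞 M) - τ • σ • α ∈ P := by
    have := Ideal.smul_mem_pointwise_smul τ _ P hσ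
    rw [MulAction.mem_stabilizer_iff.1 hτ, smul_sub] at this
    rwa [show τ • (k : 𝓞 M) = k from map_intCast (MulSemiringAction.toRingHom Gal(M/ℚ) (𝓞 M) τ) k]
      at this
  have h2 : τ • σ • α - σ • α ∈ P := by
    have := P.sub_mem hσ h1
    rwa [sub_sub_sub_cancel_left] at this
  refine hC p hp ((le_max_right _ _).trans_lt hpB) P hP hmem (Ideal.mem_of_dvd _ ?_ h2)
  exact (Finset.dvd_prod_of_mem _ (Finset.mem_erase.2 ⟨hne, Finset.mem_univ τ⟩)).trans
    (Finset.dvd_prod_of_mem (fun σ => ∏ τ ∈ (Finset.univ : Finset Gal(M/ℚ)).erase 1,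
      (τ • σ • α - σ • α)) (Finset.mem_univ σ))

end SplitPrimes

/-! ### Congruence properties of completely split primes -/

section Congruences

variable {M : Type*} [Field M] [NumberField M]

/-- If the decomposition group is trivial, then so is the Frobenius, and the residue field is
`𝔽_p`. -/
theorem pow_sub_mem_of_stabilizer_eq_bot [IsGalois ℚ M] {P : Ideal (𝓞 M)} [P.IsPrime] {p : ℕ}
    (hp : p.Prime) (hP : (p : 𝓞 M) ∈ P) (h : MulAction.stabilizer Gal(M/ℚ) P = ⊥) (x : 𝓞 M) :
    x ^ p - x ∈ P := by
  have := Ideal.finiteQuotientOfFreeOfNeBot P (ne_bot_of_natCast_mem hp hP)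
  obtain ⟨σ, hσ⟩ := IsArithFrobAt.exists_of_isInvariant ℤ Gal(M/ℚ) P
  have h1 : σ = 1 := by simpa [h] using hσ.mem_stabilizer
  have hcard : Nat.card (ℤ ⧸ P.under ℤ) = p := by
    rw [← (liesOver_span_of_natCast_mem hp hP).over,
      Nat.card_congr (Int.quotientSpanNatEquivZMod p).toEquiv, Nat.card_zmod]
  have := hσ x
  rw [hcard, h1] at this
  rw [← neg_sub]
  refine P.neg_mem ?_
  simpa using this

theorem pow_sub_one_mem_of_stabilizer_eq_bot [IsGalois ℚ M] {P : Ideal (𝓞 M)} [P.IsPrime] {p : ℕ}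
    (hp : p.Prime) (hP : (p : 𝓞 M) ∈ P) (h : MulAction.stabilizer Gal(M/ℚ) P = ⊥) {x : 𝓞 M}
    (hx : x ∉ P) : x ^ (p - 1) - 1 ∈ P := by
  have h1 := pow_sub_mem_of_stabilizer_eq_bot hp hP h x
  have h2 : x ^ p - x = x * (x ^ (p - 1) - 1) := by
    conv_lhs => rw [← Nat.sub_add_cancel hp.one_le]
    ring
  rw [h2] at h1
  exact (Ideal.IsPrime.mem_or_mem ‹_› h1).resolve_left hx

theorem dvd_sub_one_of_stabilizer_eq_bot [IsGalois ℚ M] {P : Ideal (𝓞 M)} [P.IsPrime] {p : ℕ}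
    (hp : p.Prime) (hP : (p : 𝓞 M) ∈ P) (h : MulAction.stabilizer Gal(M/ℚ) P = ⊥)
    {n : ℕ} (hn : 0 < n) (hnp : n < p) {ζ : 𝓞 M} (hζ : IsPrimitiveRoot ζ n) : n ∣ p - 1 := by
  have hnP : (n : 𝓞 M) ∉ P := by
    have := (intCast_mem_iff_dvd hp hP n).not.2 (by
      rw [Int.natCast_dvd_natCast]; exact Nat.not_dvd_of_pos_of_lt hn hnp)
    exact_mod_cast this
  have hζP : ζ ∉ P := fun hmem => (Ideal.IsPrime.ne_top ‹_›)
    (Ideal.eq_top_of_isUnit_mem P hmem (hζ.isUnit hn.ne'))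
  refine hζ.dvd_of_pow_eq_one _ (eq_of_pow_eq_one_of_sub_mem hnP ?_ (one_pow n)
    (pow_sub_one_mem_of_stabilizer_eq_bot hp hP h hζP))
  rw [← pow_mul, mul_comm, pow_mul, hζ.pow_eq_one, one_pow]

/-- If `ℓ` has an `n`-th root in a field in which `p` splits completely, then `ℓ` satisfies Euler's
criterion for being an `n`-th power modulo `p`. -/
theorem natCast_pow_eq_one_of_stabilizer_eq_bot [IsGalois ℚ M] {P : Ideal (𝓞 M)} [P.IsPrime]
    {p : ℕ} (hp : p.Prime) (hP : (p : 𝓞 M) ∈ P) (h : MulAction.stabilizer Gal(M/ℚ) P = ⊥)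
    {n m ℓ : ℕ} (hnm : p - 1 = n * m) (hℓp : ¬ p ∣ ℓ) {β : 𝓞 M} (hβ : β ^ n = ℓ) :
    (ℓ : ZMod p) ^ m = 1 := by
  have hn : n ≠ 0 := by
    rintro rfl
    have := hp.two_le
    omega
  have hβP : β ∉ P := fun hmem => hℓp (by
    have : ((ℓ : ℤ) : 𝓞 M) ∈ P := by
      rw [Int.cast_natCast, ← hβ]; exact P.pow_mem_of_mem hmem n (Nat.pos_of_ne_zero hn)
    exact Int.natCast_dvd_natCast.1 ((intCast_mem_iff_dvd hp hP _).1 this))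
  have := pow_sub_one_mem_of_stabilizer_eq_bot hp hP h hβP
  rw [hnm, pow_mul, hβ] at this
  have h2 : (((ℓ : ℤ) ^ m - 1 : ℤ) : 𝓞 M) ∈ P := by push_cast; exact this
  rw [intCast_mem_iff_dvd hp hP] at h2
  have := (ZMod.intCast_zmod_eq_zero_iff_dvd _ p).2 h2
  push_cast at this
  exact sub_eq_zero.1 this

/-- The primes used for twisting: `p` splits completely in `L`, is congruent to `1` modulo `n`, and
all primes up to `B` are `n`-th powers modulo `p`, as expressed by Euler's criterion. They are the
primes that split completely in a Galois number field containing `L`, the `n`-th roots of unity and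
`n`-th roots of the primes up to `B`. -/
theorem exists_twisting_prime (L : Type*) [Field L] [NumberField L] [IsGalois ℚ L] {n : ℕ}
    (hn : 0 < n) (B C : ℕ) :
    ∃ p : ℕ, p.Prime ∧ B < p ∧ C < p ∧ n ∣ p - 1 ∧
      (∀ ℓ : ℕ, ℓ.Prime → ℓ ≤ B → (ℓ : ZMod p) ^ ((p - 1) / n) = 1) ∧
      ∀ Q : Ideal (𝓞 L), Q.IsPrime → (p : 𝓞 L) ∈ Q → MulAction.stabilizer Gal(L/ℚ) Q = ⊥ := by
  let Ω := AlgebraicClosure L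
  have : IsGalois ℚ Ω := isGalois_rat_algebraicClosure L
  choose r hr using fun ℓ : ℕ => IsAlgClosed.exists_pow_nat_eq (ℓ : Ω) hn
  have : NeZero n := ⟨hn.ne'⟩
  obtain ⟨ζ, hζ⟩ := HasEnoughRootsOfUnity.exists_primitiveRoot Ω n
  obtain ⟨β, hβ⟩ := Field.exists_primitive_element ℚ L
  let S : Set Ω := insert (algebraMap L Ω β) (insert ζ (r '' Set.Iic B))
  have : Finite S := (((Set.finite_Iic B).image r).insert _ |>.insert _)
  let M : IntermediateField ℚ Ω := (FiniteGaloisIntermediateField.adjoin ℚ S).toIntermediateField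
  have : FiniteDimensional ℚ M := (FiniteGaloisIntermediateField.adjoin ℚ S).finiteDimensional
  have : IsGalois ℚ M := (FiniteGaloisIntermediateField.adjoin ℚ S).isGalois
  have hS : S ⊆ (M : Set Ω) := FiniteGaloisIntermediateField.subset_adjoin ℚ S
  have hL : ∀ x : L, algebraMap L Ω x ∈ M := by
    intro x
    have hle : IntermediateField.adjoin ℚ {β} ≤
        M.comap (IsScalarTower.toAlgHom ℚ L Ω) :=
      IntermediateField.adjoin_simple_le_iff.2 (hS (Set.mem_insert _ _))
    exact hle (hβ ▸ IntermediateField.mem_top : x ∈ IntermediateField.adjoin ℚ {β})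
  let _ : Algebra L M := ((algebraMap L Ω).codRestrict M.toSubring hL).toAlgebra
  have : NumberField M := { }
  obtain ⟨p, hp, hpB, hpstab⟩ := exists_prime_gt_stabilizer_eq_bot M (max n (max B C))
  simp only [max_lt_iff] at hpB
  obtain ⟨P, hP, hPp⟩ : ∃ P : Ideal (𝓞 M), P.IsPrime ∧ (p : 𝓞 M) ∈ P := by
    have hprime : (Ideal.span {(p : ℤ)}).IsPrime :=
      (Ideal.span_singleton_prime (Nat.cast_ne_zero.2 hp.ne_zero)).2 (Nat.prime_iff_prime_int.1 hp)
    obtain ⟨P, hP, hPp⟩ := exists_isPrime_comap_eq (S := 𝓞 M) (Ideal.span {(p : ℤ)})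
    refine ⟨P, hP, ?_⟩
    have : (p : ℤ) ∈ P.comap (algebraMap ℤ (𝓞 M)) := hPp ▸ Ideal.mem_span_singleton_self _
    simpa using this
  have hdvd : n ∣ p - 1 := by
    have hζM : ζ ∈ M := hS (Set.mem_insert_of_mem _ (Set.mem_insert _ _))
    have hζ' : IsPrimitiveRoot (⟨ζ, hζM⟩ : M) n :=
      IsPrimitiveRoot.of_map_of_injective (f := algebraMap M Ω) hζ
        (FaithfulSMul.algebraMap_injective M Ω)
    exact dvd_sub_one_of_stabilizer_eq_bot hp hPp (hpstab P hP hPp) hn hpB.1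
      hζ'.toInteger_isPrimitiveRoot
  refine ⟨p, hp, hpB.2.1, hpB.2.2, hdvd, fun ℓ hℓ hℓB => ?_, fun Q hQ hQp => ?_⟩
  · have hrM : r ℓ ∈ M := hS (Set.mem_insert_of_mem _ (Set.mem_insert_of_mem _ ⟨ℓ, hℓB, rfl⟩))
    have hrint : (⟨r ℓ, hrM⟩ : M) ^ n = ℓ := Subtype.ext (hr ℓ)
    let b : 𝓞 M := ⟨⟨r ℓ, hrM⟩, IsIntegral.of_pow hn (by
      rw [hrint]; exact map_natCast (algebraMap ℤ M) ℓ ▸ isIntegral_algebraMap)⟩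
    refine natCast_pow_eq_one_of_stabilizer_eq_bot hp hPp (hpstab P hP hPp)
      (Nat.mul_div_cancel' hdvd).symm (fun h => ?_) (β := b) (RingOfIntegers.ext hrint)
    have := Nat.le_of_dvd hℓ.pos h
    omega
  · obtain ⟨P, hP, hPQ, hlift⟩ := exists_prime_stabilizer_lift (M := M) Q
    refine (Subgroup.eq_bot_iff_forall _).2 fun σ hσ => ?_
    obtain ⟨τ, hτ, rfl⟩ := hlift σ hσ
    have hPp' : (p : 𝓞 M) ∈ P := by
      rw [← hPQ] at hQp
      simpa using hQp
    rw [hpstab P hP hPp', Subgroup.mem_bot] at hτ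
    rw [hτ, map_one]

end Congruences

/-! ### Local cyclicity of a twist -/

theorem IsPrimitiveRoot.autToPow_eq_natCast {R S : Type*} [CommRing R] [CommRing S] [IsDomain S]
    [Algebra R S] {μ : S} {n : ℕ} [NeZero n] (hμ : IsPrimitiveRoot μ n) {f : S ≃ₐ[R] S} {m : ℕ}
    (h : f μ = μ ^ m) : (hμ.autToPow R f : ZMod n) = m := by
  rw [← hμ.autToPow_spec R f, (hμ.isOfFinOrder (NeZero.ne n)).pow_eq_pow_iff_modEq,
    ← hμ.eq_orderOf, ← ZMod.natCast_eq_natCast_iff, ZMod.natCast_zmod_val] at h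
  exact h

section LocallyCyclic

variable {L₀ L M : Type*} [Field L₀] [NumberField L₀] [IsGalois ℚ L₀]
  [Field L] [NumberField L] [IsGalois ℚ L] [Field M] [NumberField M] [IsGalois ℚ M]
  [Algebra L₀ M] [Algebra L M] {G : Type*} [Group G]

/-- Local cyclicity of `L` can be tested on the images of the decomposition groups of an extension
`M`. Infinite places need no hypothesis, as their decomposition groups have order at most two. -/
theorem isLocallyCyclic_of_isCyclic_map {ψ : Gal(L/ℚ) →* G} (hψ : Function.Injective ψ)
    (h : ∀ P : Ideal (𝓞 M), P.IsPrime → P ≠ ⊥ → IsCyclic ((MulAction.stabilizer Gal(M/ℚ) P).map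
      (ψ.comp (AlgEquiv.restrictNormalHom L)))) :
    IsLocallyCyclic ℚ L where
  finitePrimes Q hQ hQbot := by
    obtain ⟨P, hP, hPQ, hlift⟩ := exists_prime_stabilizer_lift (M := M) Q
    have hPbot : P ≠ ⊥ := by
      rintro rfl
      apply hQbot
      rw [← hPQ, ← RingHom.ker_eq_comap_bot, (RingHom.injective_iff_ker_eq_bot _).1
        (FaithfulSMul.algebraMap_injective (𝓞 L) (𝓞 M))]
    have := h P hP hPbot
    refine isCyclic_of_injective ((ψ.comp (Subgroup.subtype _)).codRestrict
      ((MulAction.stabilizer Gal(M/ℚ) P).map (ψ.comp (AlgEquiv.restrictNormalHom L))) ?_) ?_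
    · rintro ⟨σ, hσ⟩
      obtain ⟨τ, hτ, rfl⟩ := hlift σ hσ
      exact ⟨τ, hτ, rfl⟩
    · intro σ τ hστ
      exact Subtype.ext (hψ (congrArg Subtype.val hστ))
  infinitePrimes w := isCyclic_of_card_dvd_prime (p := 2) (by
    rcases InfinitePlace.nat_card_stabilizer_eq_one_or_two ℚ w with h | h
    · exact h ▸ one_dvd 2
    · exact h.dvd)

/-- **Local cyclicity of a twist.** Let `ψ` be the twist of `ψ₀` by a character `e` of the `p`-th
cyclotomic field. The decomposition groups over `p` become trivial in `L₀`, hence have image in the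
range of `e`; those over a prime `ℓ` which ramifies in `L₀` are only seen by `ψ₀`, because they
act on `p`-th roots of unity through powers of `ℓ`; over every other prime nothing ramifies. -/
theorem isLocallyCyclic_of_twist {p : ℕ} [NeZero p] (hp : p.Prime) {ζ : M}
    (hζ : IsPrimitiveRoot ζ p)
    (hM : ∀ σ : Gal(M/ℚ), AlgEquiv.restrictNormalHom L₀ σ = 1 → σ ζ = ζ → σ = 1)
    {ψ₀ : Gal(L₀/ℚ) →* G} {ψ : Gal(L/ℚ) →* G} (hψ : Function.Injective ψ)
    {e : (ZMod p)ˣ →* G} (he : IsCyclic e.range)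
    (htwist : ∀ σ : Gal(M/ℚ), ψ (AlgEquiv.restrictNormalHom L σ) =
      ψ₀ (AlgEquiv.restrictNormalHom L₀ σ) * e (hζ.autToPow ℚ σ))
    (hL₀ : IsLocallyCyclic ℚ L₀)
    (hsplit : ∀ Q : Ideal (𝓞 L₀), Q.IsPrime → (p : 𝓞 L₀) ∈ Q →
      MulAction.stabilizer Gal(L₀/ℚ) Q = ⊥)
    (hram : ∀ ℓ : ℕ, ℓ.Prime → ∀ Q : Ideal (𝓞 L₀), Q.IsPrime → (ℓ : 𝓞 L₀) ∈ Q →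
      Q.inertia Gal(L₀/ℚ) ≠ ⊥ → ∀ u : (ZMod p)ˣ, (u : ZMod p) = ℓ → e u = 1) :
    IsLocallyCyclic ℚ L := by
  refine isLocallyCyclic_of_isCyclic_map (M := M) hψ fun P hP hPbot => ?_
  obtain ⟨ℓ, hℓ, hℓP⟩ := exists_prime_natCast_mem P hPbot
  set Q := P.comap (algebraMap (𝓞 L₀) (𝓞 M)) with hQdef
  have hQ : Q.IsPrime := Ideal.IsPrime.comap _
  have hℓQ : (ℓ : 𝓞 L₀) ∈ Q := by simpa [hQdef] using hℓP
  have hQbot : Q ≠ ⊥ := ne_bot_of_natCast_mem hℓ hℓQ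
  by_cases hℓp : ℓ = p
  · subst hℓp
    refine Subgroup.isCyclic_of_le (H' := e.range) ?_
    rintro _ ⟨σ, hσ, rfl⟩
    have h1 := restrictNormalHom_mem_stabilizer (L := L₀) hσ
    rw [hsplit _ hQ hℓQ, Subgroup.mem_bot] at h1
    rw [MonoidHom.comp_apply, htwist, h1, map_one, one_mul]
    exact ⟨_, rfl⟩
  have hpP : (p : 𝓞 M) ∉ P := by
    have := (intCast_mem_iff_dvd hℓ hℓP p).not.2 (by
      rw [Int.natCast_dvd_natCast]; exact fun h => hℓp ((Nat.prime_dvd_prime_iff_eq hℓ hp).1 h))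
    exact_mod_cast this
  have hζpow : hζ.toInteger ^ p = 1 := hζ.toInteger_isPrimitiveRoot.pow_eq_one
  have hσpow (σ : Gal(M/ℚ)) : (σ • hζ.toInteger) ^ p = 1 := by
    rw [← smul_pow', hζpow, smul_one]
  by_cases hin : Q.inertia Gal(L₀/ℚ) = ⊥
  · have hPin : P.inertia Gal(M/ℚ) = ⊥ := (Subgroup.eq_bot_iff_forall _).2 fun σ hσ => by
      apply hM
      · have h1 := restrictNormalHom_mem_inertia (L := L₀) hσ
        rwa [← hQdef, hin, Subgroup.mem_bot] at h1
      · exact congrArg (algebraMap (𝓞 M) M)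
          (eq_of_pow_eq_one_of_sub_mem hpP (hσpow σ) hζpow (hσ hζ.toInteger))
    have := isCyclic_stabilizer_of_inertia_eq_bot hPbot hPin
    exact isCyclic_of_surjective _ (MonoidHom.subgroupMap_surjective
      (ψ.comp (AlgEquiv.restrictNormalHom L)) (MulAction.stabilizer Gal(M/ℚ) P))
  · have := hL₀.finitePrimes Q hQ hQbot
    have hcyc : IsCyclic ((MulAction.stabilizer Gal(L₀/ℚ) Q).map ψ₀) :=
      isCyclic_of_surjective _ (MonoidHom.subgroupMap_surjective ψ₀ _)
    refine Subgroup.isCyclic_of_le (H' := (MulAction.stabilizer Gal(L₀/ℚ) Q).map ψ₀) ?_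
    rintro _ ⟨σ, hσ, rfl⟩
    obtain ⟨k, hk⟩ := exists_pow_frobenius_of_mem_stabilizer hℓ hℓP hσ
    have h1 : σ • hζ.toInteger = hζ.toInteger ^ ℓ ^ k :=
      eq_of_pow_eq_one_of_sub_mem hpP (hσpow σ)
        (by rw [← pow_mul, mul_comm, pow_mul, hζpow, one_pow]) (hk _)
    have h2 : σ ζ = ζ ^ ℓ ^ k := congrArg (algebraMap (𝓞 M) M) h1
    let u : (ZMod p)ˣ := ZMod.unitOfCoprime ℓ ((Nat.coprime_primes hℓ hp).2 hℓp)
    have hu : hζ.autToPow ℚ σ = u ^ k := by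
      refine Units.ext ((hζ.autToPow_eq_natCast h2).trans ?_)
      simp [u]
    rw [MonoidHom.comp_apply, htwist, hu, map_pow, hram ℓ hℓ Q hQ hℓQ hin u rfl, one_pow, mul_one]
    exact ⟨_, restrictNormalHom_mem_stabilizer hσ, rfl⟩

end LocallyCyclic

/-! ### Cyclotomic characters and fixed fields -/

section AbsoluteGalois

theorem AlgEquiv.restrictNormalHom_eq_one_iff {k E Ω : Type*} [Field k] [Field E] [Field Ω]
    [Algebra k E] [Algebra k Ω] [Algebra E Ω] [IsScalarTower k E Ω] [Normal k E] {σ : Gal(Ω/k)} :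
    AlgEquiv.restrictNormalHom E σ = 1 ↔ ∀ x : E, σ (algebraMap E Ω x) = algebraMap E Ω x := by
  rw [AlgEquiv.ext_iff]
  refine forall_congr' fun x => ?_
  rw [← (FaithfulSMul.algebraMap_injective E Ω).eq_iff]
  exact Eq.congr_left (AlgEquiv.restrictNormal_commutes σ E x)

open IntermediateField in
/-- If `M ∩ E = k`, every automorphism of the finite normal extension `E/k` extends to one that is
trivial on `M`: the restrictions to `E` of the automorphisms trivial on `M` have fixed field
`M ∩ E`. -/
theorem exists_mem_fixingSubgroup_extending {k Ω : Type*} [Field k] [Field Ω] [Algebra k Ω]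
    [IsGalois k Ω] {M E : IntermediateField k Ω} [FiniteDimensional k E] [Normal k E]
    (h : M ⊓ E = ⊥) (f : Gal(E/k)) :
    ∃ τ ∈ M.fixingSubgroup, ∀ x : E, τ x = f x := by
  have hmap : Subgroup.map (AlgEquiv.restrictNormalHom E) M.fixingSubgroup = ⊤ := by
    have h' := InfiniteGalois.restrict_fixedField M.fixingSubgroup E
    rw [InfiniteGalois.fixedField_fixingSubgroup, h] at h'
    replace h' := lift_injective E ((lift_bot k E).trans h')
    rw [← fixingSubgroup_fixedField (Subgroup.map _ _), ← h', fixingSubgroup_bot]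
  obtain ⟨τ, hτ, rfl⟩ := hmap ▸ Subgroup.mem_top f
  exact ⟨τ, hτ, fun x => (AlgEquiv.restrictNormal_commutes τ E x).symm⟩

variable {Ω : Type*} [Field Ω] [CharZero Ω] [IsGalois ℚ Ω]

open IntermediateField in
/-- For almost all primes `p`, the `p`-th cyclotomic field meets a given number field only in `ℚ`,
as no extension of `ℚ` is unramified. Consequently automorphisms which are trivial on the given
field act on the `p`-th roots of unity in every possible way. -/
theorem exists_bound_autToPow_surjective (M : IntermediateField ℚ Ω) [FiniteDimensional ℚ M] :
    ∃ B : ℕ, ∀ p : ℕ, p.Prime → B < p → ∀ [NeZero p] {ζ : Ω} (hζ : IsPrimitiveRoot ζ p)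
      (u : (ZMod p)ˣ), ∃ τ ∈ M.fixingSubgroup, hζ.autToPow ℚ τ = u := by
  have : NumberField M := { }
  refine ⟨(discr M).natAbs, fun p hp hlt _ ζ hζ u => ?_⟩
  have hcyc : IsCyclotomicExtension {p} ℚ ℚ⟮ζ⟯ :=
    hζ.intermediateField_adjoin_isCyclotomicExtension ℚ
  have : NumberField ℚ⟮ζ⟯ := IsCyclotomicExtension.numberField {p} ℚ _
  have : IsGalois ℚ ℚ⟮ζ⟯ := IsCyclotomicExtension.isGalois {p} ℚ _
  have hinf : M ⊓ ℚ⟮ζ⟯ = ⊥ := by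
    have hle₁ : M ⊓ ℚ⟮ζ⟯ ≤ M := inf_le_left
    have hle₂ : M ⊓ ℚ⟮ζ⟯ ≤ ℚ⟮ζ⟯ := inf_le_right
    have : FiniteDimensional ℚ ↥(M ⊓ ℚ⟮ζ⟯) :=
      FiniteDimensional.of_injective (inclusion hle₁).toLinearMap
        (inclusion_injective hle₁)
    have : NumberField ↥(M ⊓ ℚ⟮ζ⟯) := { }
    let _ : Algebra ↥(M ⊓ ℚ⟮ζ⟯) M := (inclusion hle₁).toAlgebra
    let _ : Algebra ↥(M ⊓ ℚ⟮ζ⟯) ℚ⟮ζ⟯ := (inclusion hle₂).toAlgebra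
    have h1 := Int.natAbs_dvd_natAbs.2 (discr_dvd_discr ↥(M ⊓ ℚ⟮ζ⟯) M)
    have h2 := Int.natAbs_dvd_natAbs.2 (discr_dvd_discr ↥(M ⊓ ℚ⟮ζ⟯) ℚ⟮ζ⟯)
    rw [IsCyclotomicExtension.Rat.natAbs_discr p ℚ⟮ζ⟯] at h2
    have h3 := h2.trans (Nat.div_dvd_of_dvd (Nat.prod_primeFactors_pow_totient_ediv_dvd hp.pos))
    have hcop : Nat.Coprime (discr M).natAbs (p ^ p.totient) :=
      (Nat.Coprime.pow_left _ ((hp.coprime_iff_not_dvd).2 (Nat.not_dvd_of_pos_of_lt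
        (Int.natAbs_pos.2 (discr_ne_zero M)) hlt))).symm
    have h4 : (discr ↥(M ⊓ ℚ⟮ζ⟯)).natAbs = 1 := Nat.eq_one_of_dvd_coprimes hcop h1 h3
    by_contra hne
    have hfin : 1 < Module.finrank ℚ ↥(M ⊓ ℚ⟮ζ⟯) := by
      refine Nat.one_lt_iff_ne_zero_and_ne_one.mpr ⟨Module.finrank_pos.ne', ?_⟩
      rwa [ne_eq, IntermediateField.finrank_eq_one_iff]
    have := abs_discr_gt_two hfin
    rw [Int.abs_eq_natAbs, h4] at this
    omega
  let f : Gal(ℚ⟮ζ⟯/ℚ) := (IsCyclotomicExtension.Rat.galEquivZMod p ℚ⟮ζ⟯).symm u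
  have hgen : f (AdjoinSimple.gen ℚ ζ) = AdjoinSimple.gen ℚ ζ ^ (u : ZMod p).val := by
    rw [IsCyclotomicExtension.Rat.galEquivZMod_apply_of_pow_eq p ℚ⟮ζ⟯ f (Subtype.ext (by
      simpa using hζ.pow_eq_one)), MulEquiv.apply_symm_apply]
  have hnormal : Normal ℚ ℚ⟮ζ⟯ := inferInstance
  obtain ⟨τ, hτ, hτf⟩ := @exists_mem_fixingSubgroup_extending ℚ Ω _ _ _ _ M ℚ⟮ζ⟯
    NumberField.to_finiteDimensional hnormal hinf f
  refine ⟨τ, hτ, Units.ext ?_⟩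
  have : τ ζ = ζ ^ (u : ZMod p).val :=
    (hτf (AdjoinSimple.gen ℚ ζ)).trans (congrArg Subtype.val hgen)
  rw [hζ.autToPow_eq_natCast this, ZMod.natCast_zmod_val]

/-- The field cut out by a surjection from the absolute Galois group of `ℚ` onto a finite group
which factors through a finite extension. If the automorphisms in the kernel fix `K`, the field is
an extension of `K`. -/
theorem exists_fixedField {K : Type*} [Field K] [CharZero K] [Algebra K Ω] {G : Type*} [Group G]
    {θ : Gal(Ω/ℚ) →* G} (hθ : Function.Surjective θ)
    {M : IntermediateField ℚ Ω} [FiniteDimensional ℚ M] (hM : M.fixingSubgroup ≤ θ.ker)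
    (hK : ∀ σ ∈ θ.ker, ∀ x : K, σ (algebraMap K Ω x) = algebraMap K Ω x) :
    ∃ (L : IntermediateField K Ω) (_ : NumberField L) (_ : IsGalois ℚ L) (ψ : Gal(L/ℚ) ≃* G),
      (∀ x ∈ L, x ∈ M) ∧ ∀ σ : Gal(Ω/ℚ), ψ (AlgEquiv.restrictNormalHom L σ) = θ σ := by
  let F : IntermediateField ℚ Ω := IntermediateField.fixedField θ.ker
  have hFM : F ≤ M := by
    rw [← InfiniteGalois.fixedField_fixingSubgroup M]
    exact fun x hx σ => hx ⟨σ, hM σ.2⟩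
  have : FiniteDimensional ℚ F := FiniteDimensional.of_injective
    (IntermediateField.inclusion hFM).toLinearMap (IntermediateField.inclusion_injective hFM)
  have hclosed : IsClosed (θ.ker : Set Gal(Ω/ℚ)) :=
    Subgroup.isClosed_of_isOpen _
      (Subgroup.isOpen_mono hM (IntermediateField.fixingSubgroup_isOpen M))
  have hfix : F.fixingSubgroup = θ.ker :=
    InfiniteGalois.fixingSubgroup_fixedField ⟨θ.ker, hclosed⟩
  have : IsGalois ℚ F := (InfiniteGalois.normal_iff_isGalois F).1 (hfix ▸ inferInstance)
  let L : IntermediateField K Ω := { F.toSubfield with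
    algebraMap_mem' := fun x σ => hK σ σ.2 x }
  let e : F ≃+* L := RingEquiv.refl F
  let e' : F ≃ₐ[ℚ] L := AlgEquiv.ofRingEquiv (f := e) (fun q => map_ratCast e q)
  have : NumberField F := { }
  have hL : NumberField L := NumberField.of_ringEquiv F L e
  have hG : IsGalois ℚ L := IsGalois.of_algEquiv e'
  have hker : (AlgEquiv.restrictNormalHom L : Gal(Ω/ℚ) →* Gal(L/ℚ)).ker = θ.ker := by
    rw [← hfix]
    ext σ
    exact AlgEquiv.restrictNormalHom_eq_one_iff
  refine ⟨L, hL, hG, ((QuotientGroup.quotientKerEquivOfSurjective _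
    (AlgEquiv.restrictNormalHom_surjective Ω)).symm.trans
      (QuotientGroup.quotientMulEquivOfEq hker)).trans
      (QuotientGroup.quotientKerEquivOfSurjective θ hθ), fun x hx => hFM hx, fun σ => ?_⟩
  have hσ : (QuotientGroup.quotientKerEquivOfSurjective _
    (AlgEquiv.restrictNormalHom_surjective (F := ℚ) (K₁ := L) Ω)).symm
    (AlgEquiv.restrictNormalHom L σ) = QuotientGroup.mk σ := (MulEquiv.symm_apply_eq _).2 rfl
  rw [MulEquiv.trans_apply, MulEquiv.trans_apply, hσ]
  rfl

end AbsoluteGalois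

/-! ### Construction of the twists -/

/-- A cyclic group of order `n` dividing `p - 1` is a quotient of `(ℤ/p)ˣ`. The kernel contains the
`n`-th powers, which by Euler's criterion are the `u` with `u ^ ((p - 1) / n) = 1`. -/
theorem exists_surjective_hom_of_card_dvd {p : ℕ} [Fact p.Prime] {A : Type*} [Group A] [Finite A]
    [IsCyclic A] (h : Nat.card A ∣ p - 1) :
    ∃ e : (ZMod p)ˣ →* A, Function.Surjective e ∧
      ∀ u, u ^ ((p - 1) / Nat.card A) = 1 → e u = 1 := by
  obtain ⟨g, hg⟩ := IsCyclic.exists_generator (α := (ZMod p)ˣ)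
  obtain ⟨c, hc⟩ := IsCyclic.exists_generator (α := A)
  have hgo : orderOf g = p - 1 := by
    rw [orderOf_eq_card_of_forall_mem_zpowers hg, Nat.card_eq_fintype_card, ZMod.card_units]
  have hco : orderOf c = Nat.card A := orderOf_eq_card_of_forall_mem_zpowers hc
  have hdvd : orderOf c ∣ orderOf g := by rwa [hgo, hco]
  have hp : 0 < p - 1 := Nat.sub_pos_of_lt (Fact.out : p.Prime).one_lt
  refine ⟨monoidHomOfForallMemZpowers hg hdvd, fun a => ?_, fun u hu => ?_⟩
  · obtain ⟨k, rfl⟩ := hc a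
    exact ⟨g ^ k, by rw [map_zpow, monoidHomOfForallMemZpowers_apply_gen]⟩
  · obtain ⟨k, rfl⟩ := mem_powers_iff_mem_zpowers.2 (hg u)
    obtain ⟨m, hm⟩ := h
    have hm0 : 0 < m := Nat.pos_of_ne_zero (by rintro rfl; omega)
    simp only [← pow_mul] at hu
    rw [← orderOf_dvd_iff_pow_eq_one, hgo, hm, Nat.mul_div_cancel_left _ Nat.card_pos] at hu
    rw [map_pow, monoidHomOfForallMemZpowers_apply_gen, ← orderOf_dvd_iff_pow_eq_one, hco]
    exact Nat.dvd_of_mul_dvd_mul_right hm0 hu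

section Twist

variable {G : Type*} [Group G] [Finite G] {N : Subgroup G} [N.Normal]
  {K : Type*} [Field K] [NumberField K] [IsGalois ℚ K]

/-- Twisting a locally cyclic embedding `L₀` by a suitable character of prime conductor yields a
locally cyclic embedding which is linearly disjoint over `K` from every finite extension of `K`
inside a prescribed number field `M₁` containing `L₀`. -/
theorem exists_isLocallyCyclicEmbedding_linearDisjoint (hcentral : N ≤ Subgroup.center G)
    (hcyclic : IsCyclic N) {φ : Gal(K/ℚ) ≃* G ⧸ N}
    {L₀ : IntermediateField K (AlgebraicClosure K)} (h₀ : IsLocallyCyclicEmbedding φ L₀)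
    (M₁ : IntermediateField ℚ (AlgebraicClosure K)) [FiniteDimensional ℚ M₁]
    (hM₁ : L₀.restrictScalars ℚ ≤ M₁) :
    ∃ L : IntermediateField K (AlgebraicClosure K), IsLocallyCyclicEmbedding φ L ∧
      ∀ L' : IntermediateField K (AlgebraicClosure K), FiniteDimensional K L' →
        L'.restrictScalars ℚ ≤ M₁ → L.LinearDisjoint L' := by
  let Ω := AlgebraicClosure K
  have : IsGalois ℚ Ω := isGalois_rat_algebraicClosure K
  obtain ⟨_, _, hcyc₀, ψ₀, hψ₀⟩ := h₀
  obtain ⟨B, hB⟩ := exists_bound_inertia_eq_bot L₀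
  obtain ⟨C, hC⟩ := exists_bound_autToPow_surjective M₁
  obtain ⟨p, hp, hpB, hpC, hdvd, hpow, hsplit⟩ :=
    exists_twisting_prime L₀ (Nat.card_pos (α := N)) B C
  have : Fact p.Prime := ⟨hp⟩
  have : NeZero p := ⟨hp.ne_zero⟩
  obtain ⟨ζ, hζ⟩ := HasEnoughRootsOfUnity.exists_primitiveRoot Ω p
  -- `θ₀` is the surjection belonging to `L₀`, and `χ` is the character by which it is twisted.
  obtain ⟨e, hesurj, heker⟩ := exists_surjective_hom_of_card_dvd (A := N) hdvd
  let θ₀ : Gal(Ω/ℚ) →* G := ψ₀.toMonoidHom.comp (AlgEquiv.restrictNormalHom L₀)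
  let χ : Gal(Ω/ℚ) →* N := e.comp (hζ.autToPow ℚ)
  have hθ₀fix : ∀ σ ∈ M₁.fixingSubgroup, θ₀ σ = 1 := fun σ hσ => by
    have : AlgEquiv.restrictNormalHom L₀ σ = 1 :=
      AlgEquiv.restrictNormalHom_eq_one_iff.2 fun x => hσ ⟨x, hM₁ x.2⟩
    simp [θ₀, this]
  have hχsurj (a : N) : ∃ τ ∈ M₁.fixingSubgroup, χ τ = a := by
    obtain ⟨u, rfl⟩ := hesurj a
    obtain ⟨τ, hτ, rfl⟩ := hC p hp hpC hζ u
    exact ⟨τ, hτ, rfl⟩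
  let θ : Gal(Ω/ℚ) →* G := MonoidHom.mk' (fun σ => θ₀ σ * χ σ) fun σ τ => by
    have := Subgroup.mem_center_iff.1 (hcentral (χ σ).2) (θ₀ τ)
    simp only [map_mul, Subgroup.coe_mul]
    rw [mul_assoc, mul_assoc, ← mul_assoc (θ₀ τ), this, mul_assoc]
  have hθ (σ) : θ σ = θ₀ σ * χ σ := rfl
  -- A preimage under `θ₀` is corrected by an automorphism which only `χ` sees.
  have hθsurj : Function.Surjective θ := fun g => by
    obtain ⟨σ, hσ⟩ := ψ₀.surjective g
    obtain ⟨σ, rfl⟩ := AlgEquiv.restrictNormalHom_surjective Ω σ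
    obtain ⟨τ, hτ, hχτ⟩ := hχsurj (χ σ)⁻¹
    refine ⟨σ * τ, ?_⟩
    rw [hθ, map_mul, map_mul, hθ₀fix τ hτ, hχτ]
    simpa [θ₀] using hσ
  have hθφ (σ) : QuotientGroup.mk' N (θ σ) = φ (AlgEquiv.restrictNormalHom K σ) := by
    have h1 : QuotientGroup.mk' N (χ σ : G) = 1 := (QuotientGroup.eq_one_iff _).2 (χ σ).2
    rw [hθ, map_mul, h1, mul_one]
    refine (hψ₀ _).trans (congrArg φ ?_)
    exact (IsScalarTower.AlgEquiv.restrictNormalHom_comp_apply K L₀ σ).symm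
  -- Decomposition groups are studied in `M = L₀(ζ)`, through which `θ` factors.
  let M : IntermediateField ℚ Ω := L₀.restrictScalars ℚ ⊔ IntermediateField.adjoin ℚ {ζ}
  have hL₀fin : FiniteDimensional ℚ (L₀.restrictScalars ℚ) :=
    NumberField.to_finiteDimensional (K := L₀)
  have hζint : IsIntegral ℚ ζ := (hζ.isIntegral hp.pos).tower_top
  have hζfin : FiniteDimensional ℚ (IntermediateField.adjoin ℚ {ζ}) :=
    IntermediateField.adjoin.finiteDimensional hζint
  have hL₀normal : Normal ℚ (L₀.restrictScalars ℚ) := IsGalois.to_normal (F := ℚ) (E := L₀)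
  have hcyc : IsCyclotomicExtension {p} ℚ (IntermediateField.adjoin ℚ {ζ}) :=
    hζ.intermediateField_adjoin_isCyclotomicExtension ℚ
  have hζgal : IsGalois ℚ (IntermediateField.adjoin ℚ {ζ}) :=
    IsCyclotomicExtension.isGalois {p} ℚ _
  have hMfin : FiniteDimensional ℚ M := IntermediateField.finiteDimensional_sup _ _
  have hMnormal : Normal ℚ M :=
    @IntermediateField.normal_sup ℚ Ω _ _ _ _ _ hL₀normal hζgal.to_normal
  have : NumberField M := { }
  have : IsGalois ℚ M := { }
  have hL₀M : L₀.restrictScalars ℚ ≤ M := le_sup_left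
  have hζM : ζ ∈ M := (le_sup_right : _ ≤ M) (IntermediateField.mem_adjoin_simple_self ℚ ζ)
  have hMfix : ∀ σ : Gal(Ω/ℚ), (∀ x ∈ L₀, σ x = x) → σ ζ = ζ → ∀ x ∈ M, σ x = x := by
    intro σ h1 h2 x hx
    have hle : M ≤ IntermediateField.fixedField (Subgroup.zpowers σ) := by
      refine sup_le (fun y hy => ?_) (IntermediateField.adjoin_simple_le_iff.2 ?_)
      · exact IntermediateField.mem_fixedField_zpowers_iff.2 (h1 y hy)
      · exact IntermediateField.mem_fixedField_zpowers_iff.2 h2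
    exact IntermediateField.mem_fixedField_zpowers_iff.1 (hle hx)
  have hfixM : M.fixingSubgroup ≤ θ.ker := fun σ hσ => by
    have h1 : AlgEquiv.restrictNormalHom L₀ σ = 1 :=
      AlgEquiv.restrictNormalHom_eq_one_iff.2 fun x => hσ ⟨x, hL₀M x.2⟩
    have h2 : hζ.autToPow ℚ σ = 1 := Units.ext (by
      rw [hζ.autToPow_eq_natCast (m := 1) (by rw [pow_one]; exact hσ ⟨ζ, hζM⟩)]
      simp)
    rw [MonoidHom.mem_ker, hθ]
    simp [θ₀, χ, h1, h2]
  have hK : ∀ σ ∈ θ.ker, ∀ x : K, σ (algebraMap K Ω x) = algebraMap K Ω x := fun σ hσ => by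
    rw [← AlgEquiv.restrictNormalHom_eq_one_iff]
    apply φ.injective
    rw [← hθφ, MonoidHom.mem_ker.1 hσ, map_one, map_one]
  obtain ⟨L, _, _, ψ, hLM, hψ⟩ := exists_fixedField hθsurj hfixM hK
  refine ⟨L, ⟨‹_›, ‹_›, ?_, ψ, fun σ => ?_⟩, fun L' hL' hL'M₁ => ?_⟩
  · let _ : Algebra L₀ M :=
      ((algebraMap L₀ Ω).codRestrict M.toSubring fun x => hL₀M x.2).toAlgebra
    let _ : Algebra L M :=
      ((algebraMap L Ω).codRestrict M.toSubring fun x => hLM _ x.2).toAlgebra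
    have : IsScalarTower L₀ M Ω := .of_algebraMap_eq fun _ => rfl
    have : IsScalarTower L M Ω := .of_algebraMap_eq fun _ => rfl
    have hζ' : IsPrimitiveRoot (⟨ζ, hζM⟩ : M) p :=
      IsPrimitiveRoot.of_map_of_injective (f := algebraMap M Ω) hζ
        (FaithfulSMul.algebraMap_injective M Ω)
    refine isLocallyCyclic_of_twist (L₀ := L₀) hp hζ' (fun σ hσ hσζ => ?_) (ψ₀ := ψ₀.toMonoidHom)
      (ψ := ψ.toMonoidHom) ψ.injective (e := N.subtype.comp e) ?_ (fun σ => ?_) hcyc₀ hsplit ?_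
    · obtain ⟨σ, rfl⟩ := AlgEquiv.restrictNormalHom_surjective (F := ℚ) (K₁ := M) Ω σ
      rw [← IsScalarTower.AlgEquiv.restrictNormalHom_comp_apply,
        AlgEquiv.restrictNormalHom_eq_one_iff] at hσ
      refine AlgEquiv.restrictNormalHom_eq_one_iff.2 fun x =>
        hMfix σ (fun y hy => hσ ⟨y, hy⟩) ?_ x x.2
      exact (AlgEquiv.restrictNormal_commutes σ M ⟨ζ, hζM⟩).symm.trans
        (congrArg (algebraMap M Ω) hσζ)
    · refine Subgroup.isCyclic_of_le (H' := N) ?_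
      rintro _ ⟨u, rfl⟩
      exact (e u).2
    · obtain ⟨σ, rfl⟩ := AlgEquiv.restrictNormalHom_surjective (F := ℚ) (K₁ := M) Ω σ
      have hχM : hζ'.autToPow ℚ (AlgEquiv.restrictNormalHom M σ) = hζ.autToPow ℚ σ := by
        refine Units.ext ((hζ'.autToPow_eq_natCast (m := (hζ.autToPow ℚ σ : ZMod p).val) ?_).trans
          (ZMod.natCast_zmod_val _))
        apply FaithfulSMul.algebraMap_injective M Ω
        refine (AlgEquiv.restrictNormal_commutes σ M ⟨ζ, hζM⟩).trans ?_
        rw [map_pow]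
        exact (hζ.autToPow_spec ℚ σ).symm
      rw [hχM, ← IsScalarTower.AlgEquiv.restrictNormalHom_comp_apply,
        ← IsScalarTower.AlgEquiv.restrictNormalHom_comp_apply]
      exact (hψ σ).trans (hθ σ)
    · intro ℓ hℓ Q hQ hℓQ hin u hu
      have hℓB : ℓ ≤ B := not_lt.1 fun hlt => hin (hB ℓ hℓ hlt Q hQ hℓQ)
      have : e u = 1 := heker u (Units.ext (by
        rw [Units.val_pow_eq_pow_val, hu]; exact hpow ℓ hℓ hℓB))
      simp [this]
  · obtain ⟨σ, rfl⟩ := AlgEquiv.restrictNormalHom_surjective (F := ℚ) (K₁ := L) Ω σ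
    rw [hψ, hθφ, ← IsScalarTower.AlgEquiv.restrictNormalHom_comp_apply]
  · have : IsGalois K L := IsGalois.tower_top_of_isGalois ℚ K L
    have : FiniteDimensional K L := FiniteDimensional.right ℚ K L
    have : IsGalois K Ω := IsGalois.tower_top_of_isGalois ℚ K Ω
    refine IntermediateField.LinearDisjoint.of_inf_eq_bot (eq_bot_iff.2 fun x hx => ?_)
    rw [InfiniteGalois.mem_bot_iff_fixed]
    intro σ
    let σ' : Gal(Ω/ℚ) := σ.restrictScalars ℚ
    have hσN : θ σ' ∈ N := by
      have : AlgEquiv.restrictNormalHom K σ' = 1 :=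
        AlgEquiv.restrictNormalHom_eq_one_iff.2 fun x => σ.commutes x
      rw [← QuotientGroup.eq_one_iff, ← QuotientGroup.mk'_apply, hθφ, this, map_one]
    -- `τ` is trivial on `M₁` and agrees with `σ` on `L`.
    obtain ⟨τ, hτ, hχτ⟩ := hχsurj ⟨θ σ', hσN⟩
    have hθτ : θ τ = θ σ' := by rw [hθ, hθ₀fix τ hτ, hχτ, one_mul]
    have hfix : AlgEquiv.restrictNormalHom L τ = AlgEquiv.restrictNormalHom L σ' :=
      ψ.injective (by rw [hψ, hψ, hθτ])
    calc σ x = algebraMap L Ω (AlgEquiv.restrictNormalHom L σ' ⟨x, hx.1⟩) :=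
          (AlgEquiv.restrictNormal_commutes σ' L ⟨x, hx.1⟩).symm
      _ = algebraMap L Ω (AlgEquiv.restrictNormalHom L τ ⟨x, hx.1⟩) := by rw [hfix]
      _ = τ x := AlgEquiv.restrictNormal_commutes τ L ⟨x, hx.1⟩
      _ = x := hτ ⟨x, hL'M₁ hx.2⟩

end Twist

theorem mainTheorem4 {G : Type*} [Group G] [Finite G] (N : Subgroup G) [N.Normal]
    (hcentral : N ≤ Subgroup.center G) (hcyclic : IsCyclic N) (hN : N ≠ ⊥)
    {K : Type*} [Field K] [NumberField K] [IsGalois ℚ K]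
    (φ : Gal(K/ℚ) ≃* G ⧸ N) (hK : IsLocallyCyclic ℚ K)
    (hL : ∃ L : IntermediateField K (AlgebraicClosure K), IsLocallyCyclicEmbedding φ L) :
    ∃ S : Set (IntermediateField K (AlgebraicClosure K)),
      S.Infinite ∧ (∀ L ∈ S, IsLocallyCyclicEmbedding φ L) ∧
        S.Pairwise fun L₁ L₂ => L₁.LinearDisjoint L₂ := by
  classical
  obtain ⟨L₀, h₀⟩ := hL
  have hfin {L : IntermediateField K (AlgebraicClosure K)} (h : IsLocallyCyclicEmbedding φ L) :
      FiniteDimensional ℚ (L.restrictScalars ℚ) := by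
    obtain ⟨_, _, _⟩ := h
    exact NumberField.to_finiteDimensional (K := L)
  obtain ⟨f, hf, hdisj⟩ := exists_seq_of_forall_finset_exists (IsLocallyCyclicEmbedding φ)
    (fun L₁ L₂ => L₁.LinearDisjoint L₂) fun s hs => by
      let t := insert L₀ s
      have ht : ∀ L ∈ t, IsLocallyCyclicEmbedding φ L := by simpa [t, h₀] using hs
      let M₁ : IntermediateField ℚ (AlgebraicClosure K) := ⨆ L : t, L.1.restrictScalars ℚ
      have : ∀ L : t, FiniteDimensional ℚ (L.1.restrictScalars ℚ) := fun L => hfin (ht L L.2)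
      have : FiniteDimensional ℚ M₁ := IntermediateField.finiteDimensional_iSup_of_finite
      have hle : ∀ L ∈ t, L.restrictScalars ℚ ≤ M₁ := fun L hL =>
        le_iSup (fun L : t => L.1.restrictScalars ℚ) ⟨L, hL⟩
      obtain ⟨L, hL, hL'⟩ := exists_isLocallyCyclicEmbedding_linearDisjoint hcentral hcyclic h₀ M₁
        (hle L₀ (Finset.mem_insert_self _ _))
      refine ⟨L, hL, fun L' hL's => (hL' L' ?_ (hle L' (Finset.mem_insert_of_mem hL's))).symm⟩
      obtain ⟨_, _, _⟩ := hs L' hL's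
      exact FiniteDimensional.right ℚ K L'
  have hpair : ∀ m n, m ≠ n → (f m).LinearDisjoint (f n) := fun m n hmn =>
    hmn.lt_or_gt.elim (hdisj m n) fun h => (hdisj n m h).symm
  refine ⟨Set.range f, Set.infinite_range_of_injective fun m n hmn => ?_, ?_, ?_⟩
  · by_contra hne
    -- An extension linearly disjoint from itself is trivial, contradicting `N ≠ ⊥`.
    have hself := hpair m n hne
    rw [← hmn] at hself
    have hbot : f m = ⊥ := hself.eq_bot_of_self
    obtain ⟨_, _, _, ψ, hψ⟩ := hf m
    apply hN
    refine (Subgroup.eq_bot_iff_forall N).2 fun a ha => ?_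
    obtain ⟨σ, rfl⟩ := ψ.surjective a
    have h1 : AlgEquiv.restrictNormalHom K σ = 1 := φ.injective (by
      rw [← hψ, map_one]
      exact (QuotientGroup.eq_one_iff _).2 ha)
    have h2 : σ = 1 := by
      refine AlgEquiv.ext fun ⟨x, hx⟩ => ?_
      obtain ⟨y, rfl⟩ := IntermediateField.mem_bot.1 (hbot ▸ hx)
      exact AlgEquiv.restrictNormalHom_eq_one_iff.1 h1 y
    rw [h2, map_one]
  · rintro _ ⟨n, rfl⟩
    exact hf n
  · rintro _ ⟨m, rfl⟩ _ ⟨n, rfl⟩ hne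
    exact hpair m n fun h => hne (h ▸ rfl)
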